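/- Let $H_1,H_2$ be complex Hilbert spaces with $H_1\neq\{0\}$, and let $T$ be a densely defined, closed, one-to-one linear operator with domain $D(T)\subseteq H_1$ and values in $H_2$. Write $N(T)$ and $R(T)$ for its null space and range, $C(T)=D(T)\cap N(T)^{\perp}$ for its carrier, and $$m(T)=\inf\{\|Tx\|: x\in D(T),\ \|x\|=1\},\qquad \gamma(T)=\inf\{\|Tx\|: x\in C(T),\ \|x\|=1\}.$$ Let $T^{\dagger}$ be the Moore–Penrose inverse of $T$, that is, the unique densely defined closed operator from $H_2$ to $H_1$ with domain $D(T^\dagger)=R(T)\oplus R(T)^{\perp}$ such that $TT^{\dagger}y=P_{\overline{R(T)}}\,y$ for all $y\in D(T^{\dagger})$, $T^{\dagger}Tx=P_{N(T)^{\perp}}x$ for all $x\in D(T)$, and $N(T^{\dagger})=R(T)^{\perp}$, where $P_M$ denotes the orthogonal projection onto a closed subspace $M$. Then the following are equivalent: 1. $T$ attains its reduced minimum modulus: there is $x_0\in C(T)$ with $\|x_0\|=1$ and $\|Tx_0\|=\gamma(T)$. 2. $T$ is minimum attaining: there is $x_0\in D(T)$ with $\|x_0\|=1$ and $\|Tx_0\|=m(T)$.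 3. $R(T)$ is closed and $T^{\dagger}$ is a norm attaining bounded operator: $T^{\dagger}$ is bounded and defined on all of $H_2$, and there is $y_0\in H_2$ with $\|y_0\|=1$ and $\|T^{\dagger}y_0\|=\|T^{\dagger}\|$. -/

import Mathlib

noncomputable section

namespace UnboundedOp

variable {H₁ : Type*} [NormedAddCommGroup H₁] [InnerProductSpace ℂ H₁]
variable {H₂ : Type*} [NormedAddCommGroup H₂] [InnerProductSpace ℂ H₂]

/-- The null space `N(T)`, as a subspace of the whole space `H₁`. -/
def nullSpace (T : H₁ →ₗ.[ℂ] H₂) : Submodule ℂ H₁ :=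
  (LinearMap.ker T.toFun).map T.domain.subtype

/-- The range `R(T)`. -/
def rangeSpace (T : H₁ →ₗ.[ℂ] H₂) : Submodule ℂ H₂ :=
  LinearMap.range T.toFun

/-- The carrier `C(T) = D(T) ∩ N(T)ᗮ`. -/
def carrier (T : H₁ →ₗ.[ℂ] H₂) : Submodule ℂ H₁ :=
  T.domain ⊓ (nullSpace T)ᗮ

/-- The minimum modulus `m(T)`: the infimum of `‖T x‖` over the unit sphere of `D(T)`. -/
def minModulus (T : H₁ →ₗ.[ℂ] H₂) : ℝ :=
  sInf {r : ℝ | ∃ x : T.domain, ‖(x : H₁)‖ = 1 ∧ r = ‖T x‖}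

/-- The reduced minimum modulus `γ(T)`: the infimum of `‖T x‖` over the unit sphere of `C(T)`. -/
def reducedMinModulus (T : H₁ →ₗ.[ℂ] H₂) : ℝ :=
  sInf {r : ℝ | ∃ x : T.domain, (x : H₁) ∈ carrier T ∧ ‖(x : H₁)‖ = 1 ∧ r = ‖T x‖}

/-- `T` is minimum attaining. -/
def MinAttaining (T : H₁ →ₗ.[ℂ] H₂) : Prop :=
  ∃ x : T.domain, ‖(x : H₁)‖ = 1 ∧ ‖T x‖ = minModulus T

/-- `T` attains its reduced minimum modulus. -/
def ReducedMinAttaining (T : H₁ →ₗ.[ℂ] H₂) : Prop :=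
  ∃ x : T.domain, (x : H₁) ∈ carrier T ∧ ‖(x : H₁)‖ = 1 ∧ ‖T x‖ = reducedMinModulus T

/-- `S` belongs to the class of norm attaining operators: it is an everywhere defined bounded
operator `A`, and `‖A x‖ = ‖A‖` for some unit vector `x`. -/
def NormAttaining (S : H₁ →ₗ.[ℂ] H₂) : Prop :=
  ∃ A : H₁ →L[ℂ] H₂, S = (A : H₁ →ₗ[ℂ] H₂).toPMap ⊤ ∧ ∃ x : H₁, ‖x‖ = 1 ∧ ‖A x‖ = ‖A‖

/-- The graph of the Moore-Penrose inverse: the pairs `(T x + z, x)` with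
`x ∈ C(T)` and `z ∈ R(T)ᗮ`. -/
def moorePenroseGraph (T : H₁ →ₗ.[ℂ] H₂) : Submodule ℂ (H₂ × H₁) where
  carrier := {p | ∃ x : T.domain, (x : H₁) ∈ carrier T ∧ p.2 = x ∧ p.1 - T x ∈ (rangeSpace T)ᗮ}
  zero_mem' := ⟨0, by simp⟩
  add_mem' := by
    rintro p q ⟨x, hx, hpx, hp⟩ ⟨y, hy, hqy, hq⟩
    refine ⟨x + y, by simpa using add_mem hx hy, by simp [hpx, hqy], ?_⟩
    have h := add_mem hp hq
    rw [LinearPMap.map_add, Prod.fst_add]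
    convert h using 1
    abel
  smul_mem' := by
    rintro c p ⟨x, hx, hpx, hp⟩
    refine ⟨c • x, by simpa using Submodule.smul_mem _ c hx, by simp [hpx], ?_⟩
    have h := Submodule.smul_mem _ c hp
    rw [LinearPMap.map_smul, Prod.smul_fst, ← smul_sub]
    exact h

/-- The Moore-Penrose inverse `T†`; see `isMoorePenroseInverse_iff` for the fact
that it is the unique operator with the defining properties. -/
def moorePenroseInverse (T : H₁ →ₗ.[ℂ] H₂) : H₂ →ₗ.[ℂ] H₁ :=
  (moorePenroseGraph T).toLinearPMap

/-- The defining properties of the Moore-Penrose inverse: `S` is densely defined and closed with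
domain `R(T) ⊕ R(T)ᗮ`, `T S y` is the projection of `y` to the closure of `R(T)`, `S T x` is the
projection of `x` to `N(T)ᗮ`, and `N(S) = R(T)ᗮ`. -/
structure IsMoorePenroseInverse [CompleteSpace H₁] [CompleteSpace H₂]
    (T : H₁ →ₗ.[ℂ] H₂) (S : H₂ →ₗ.[ℂ] H₁) : Prop where
  dense_domain : Dense (S.domain : Set H₂)
  isClosed : S.IsClosed
  domain_eq : S.domain = rangeSpace T ⊔ (rangeSpace T)ᗮ
  map_map : ∀ y : S.domain, ∃ h : S y ∈ T.domain,
    T ⟨S y, h⟩ = (rangeSpace T).topologicalClosure.starProjection (y : H₂)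
  map_map' : ∀ x : T.domain, ∃ h : T x ∈ S.domain,
    S ⟨T x, h⟩ = (nullSpace T)ᗮ.starProjection (x : H₁)
  nullSpace_eq : nullSpace S = (rangeSpace T)ᗮ

theorem mem_nullSpace {T : H₁ →ₗ.[ℂ] H₂} {x : H₁} :
    x ∈ nullSpace T ↔ ∃ h : x ∈ T.domain, T ⟨x, h⟩ = 0 := by
  constructor
  · rintro ⟨y, hy, rfl⟩
    exact ⟨y.2, hy⟩
  · rintro ⟨h, h0⟩
    exact ⟨⟨x, h⟩, h0, rfl⟩

theorem apply_mem_rangeSpace (T : H₁ →ₗ.[ℂ] H₂) (x : T.domain) : T x ∈ rangeSpace T :=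
  ⟨x, rfl⟩

theorem moorePenroseGraph_snd_eq_zero (T : H₁ →ₗ.[ℂ] H₂) (p : H₂ × H₁)
    (hp : p ∈ moorePenroseGraph T) (h0 : p.1 = 0) : p.2 = 0 := by
  obtain ⟨x, hx, hpx, h⟩ := hp
  have h1 : T x = 0 := by
    have h2 : inner ℂ (T x) (p.1 - T x) = 0 :=
      Submodule.inner_right_of_mem_orthogonal (apply_mem_rangeSpace T x) h
    rw [h0, zero_sub, inner_neg_right, neg_eq_zero] at h2
    exact inner_self_eq_zero.mp h2
  rw [hpx]
  have h3 : (x : H₁) ∈ nullSpace T := mem_nullSpace.mpr ⟨x.2, h1⟩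
  exact inner_self_eq_zero.mp (Submodule.inner_right_of_mem_orthogonal h3 hx.2)

theorem moorePenroseInverse_graph (T : H₁ →ₗ.[ℂ] H₂) :
    (moorePenroseInverse T).graph = moorePenroseGraph T :=
  Submodule.toLinearPMap_graph_eq _ (moorePenroseGraph_snd_eq_zero T)

theorem nullSpace_isClosed {T : H₁ →ₗ.[ℂ] H₂} (hT : T.IsClosed) :
    IsClosed (nullSpace T : Set H₁) := by
  have h : (nullSpace T : Set H₁) = (fun x => (x, (0 : H₂))) ⁻¹' (T.graph : Set (H₁ × H₂)) := by
    ext x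
    simp only [SetLike.mem_coe, Set.mem_preimage, mem_nullSpace, LinearPMap.mem_graph_iff]
    constructor
    · rintro ⟨h, h0⟩
      exact ⟨⟨x, h⟩, rfl, h0⟩
    · rintro ⟨y, rfl, h0⟩
      exact ⟨y.2, h0⟩
  rw [h]
  exact hT.preimage (by fun_prop)

theorem exists_carrier [CompleteSpace H₁] {T : H₁ →ₗ.[ℂ] H₂} (hT : T.IsClosed) (x : T.domain) :
    ∃ u : T.domain, (u : H₁) ∈ carrier T ∧ (u : H₁) = (nullSpace T)ᗮ.starProjection (x : H₁) ∧
      T u = T x := by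
  have hc : IsClosed (nullSpace T : Set H₁) := nullSpace_isClosed hT
  have : CompleteSpace (nullSpace T) := hc.completeSpace_coe
  set n := (nullSpace T).starProjection (x : H₁) with hn
  have hnN : n ∈ nullSpace T := Submodule.starProjection_apply_mem _ _
  obtain ⟨hnD, hn0⟩ := mem_nullSpace.mp hnN
  have hpr : (nullSpace T)ᗮ.starProjection (x : H₁) = x - n := by
    rw [Submodule.starProjection_orthogonal_val]
  refine ⟨x - ⟨n, hnD⟩, ⟨(x - ⟨n, hnD⟩ : T.domain).2, ?_⟩, ?_, ?_⟩
  · change (x : H₁) - n ∈ _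
    rw [← hpr]
    exact Submodule.starProjection_apply_mem _ _
  · rw [hpr]; rfl
  · rw [LinearPMap.map_sub, hn0, sub_zero]

theorem mem_moorePenroseGraph [CompleteSpace H₂] {T : H₁ →ₗ.[ℂ] H₂} {y : H₂} {x : H₁} :
    (y, x) ∈ moorePenroseGraph T ↔ x ∈ (nullSpace T)ᗮ ∧
      (x, (rangeSpace T).topologicalClosure.starProjection y) ∈ T.graph := by
  rw [LinearPMap.mem_graph_iff]
  constructor
  · rintro ⟨u, hu, rfl, h⟩
    refine ⟨hu.2, u, rfl, ?_⟩
    refine (Submodule.eq_starProjection_of_mem_orthogonal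
      (Submodule.le_topologicalClosure _ (apply_mem_rangeSpace T u)) ?_).symm
    rwa [Submodule.orthogonal_closure]
  · rintro ⟨hx, u, rfl, hu⟩
    refine ⟨u, ⟨u.2, hx⟩, rfl, ?_⟩
    rw [hu, ← Submodule.orthogonal_closure]
    exact Submodule.sub_starProjection_mem_orthogonal _

theorem moorePenroseInverse_spec [CompleteSpace H₁] [CompleteSpace H₂] {T : H₁ →ₗ.[ℂ] H₂}
    (hT : T.IsClosed) : IsMoorePenroseInverse T (moorePenroseInverse T) := by
  have hg := moorePenroseInverse_graph T
  have hdom : (moorePenroseInverse T).domain = rangeSpace T ⊔ (rangeSpace T)ᗮ := by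
    ext y
    rw [LinearPMap.mem_domain_iff, Submodule.mem_sup]
    simp only [hg]
    constructor
    · rintro ⟨x, u, hu, -, h⟩
      exact ⟨T u, apply_mem_rangeSpace T u, y - T u, h, by abel⟩
    · rintro ⟨_, ⟨u, rfl⟩, z, hz, rfl⟩
      obtain ⟨v, hv, -, hvu⟩ := exists_carrier hT u
      refine ⟨v, v, hv, rfl, ?_⟩
      change T u + z - T v ∈ _
      rw [hvu]
      simpa using hz
  have hmem : ∀ y : (moorePenroseInverse T).domain,
      ((y : H₂), moorePenroseInverse T y) ∈ moorePenroseGraph T := fun y => by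
    rw [← hg]; exact LinearPMap.mem_graph _ y
  refine ⟨?_, ?_, hdom, ?_, ?_, ?_⟩
  · rw [Submodule.dense_iff_topologicalClosure_eq_top, Submodule.topologicalClosure_eq_top_iff,
      hdom, ← Submodule.inf_orthogonal]
    exact Submodule.inf_orthogonal_eq_bot _
  · unfold LinearPMap.IsClosed
    have : (moorePenroseGraph T : Set (H₂ × H₁)) =
        (fun p : H₂ × H₁ => p.2) ⁻¹' ((nullSpace T)ᗮ : Set H₁) ∩
        (fun p : H₂ × H₁ => (p.2, (rangeSpace T).topologicalClosure.starProjection p.1)) ⁻¹'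
          (T.graph : Set (H₁ × H₂)) := by
      ext ⟨y, x⟩
      exact mem_moorePenroseGraph
    rw [hg, this]
    exact ((Submodule.isClosed_orthogonal _).preimage continuous_snd).inter
      (hT.preimage (by fun_prop))
  · intro y
    have h := (mem_moorePenroseGraph.mp (hmem y)).2
    rw [LinearPMap.mem_graph_iff] at h
    obtain ⟨u, hu, hu'⟩ := h
    change (u : H₁) = moorePenroseInverse T y at hu
    refine ⟨hu ▸ u.2, ?_⟩
    refine Eq.trans ?_ hu'
    congr 1
    exact Subtype.ext hu.symm
  · intro x
    obtain ⟨u, hu, hux, hTu⟩ := exists_carrier hT x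
    have h : (T x, (u : H₁)) ∈ (moorePenroseInverse T).graph := by
      rw [hg]
      exact ⟨u, hu, rfl, by simp [hTu]⟩
    have hd : T x ∈ (moorePenroseInverse T).domain := LinearPMap.mem_domain_of_mem_graph h
    refine ⟨hd, ?_⟩
    rw [← hux]
    exact ((LinearPMap.image_iff hd).mpr h).symm
  · ext y
    rw [mem_nullSpace]
    constructor
    · rintro ⟨h, h0⟩
      obtain ⟨u, -, hu, hu'⟩ := hmem ⟨y, h⟩
      have hu0 : u = 0 := Subtype.ext (by rw [← hu]; exact h0)
      simpa [hu0] using hu'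
    · intro hy
      have h : (y, (0 : H₁)) ∈ (moorePenroseInverse T).graph := by
        rw [hg]
        exact ⟨0, by simp, rfl, by simpa using hy⟩
      have hd := LinearPMap.mem_domain_of_mem_graph h
      exact ⟨hd, ((LinearPMap.image_iff hd).mpr h).symm⟩

/-- `moorePenroseInverse T` is the unique operator with the defining properties. -/
theorem isMoorePenroseInverse_iff [CompleteSpace H₁] [CompleteSpace H₂] {T : H₁ →ₗ.[ℂ] H₂}
    (hT : T.IsClosed) (S : H₂ →ₗ.[ℂ] H₁) :
    IsMoorePenroseInverse T S ↔ S = moorePenroseInverse T := by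
  refine ⟨fun hS => ?_, fun h => h ▸ moorePenroseInverse_spec hT⟩
  have hM := moorePenroseInverse_spec hT
  refine LinearPMap.ext (hS.domain_eq.trans hM.domain_eq.symm) ?_
  rintro y h h'
  have hy := h
  rw [hS.domain_eq, Submodule.mem_sup] at hy
  obtain ⟨_, ⟨x, rfl⟩, z, hz, rfl⟩ := hy
  have key : ∀ (R : H₂ →ₗ.[ℂ] H₁) (_ : IsMoorePenroseInverse T R) (hR : T x + z ∈ R.domain),
      R ⟨T x + z, hR⟩ = (nullSpace T)ᗮ.starProjection (x : H₁) := by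
    intro R hMP hR
    obtain ⟨h1, h2⟩ := hMP.map_map' x
    obtain ⟨h3, h4⟩ := mem_nullSpace.mp (hMP.nullSpace_eq ▸ hz)
    have : (⟨T x + z, hR⟩ : R.domain) = ⟨T x, h1⟩ + ⟨z, h3⟩ := rfl
    rw [this, LinearPMap.map_add, h2, h4, add_zero]
  exact (key S hS h).trans (key _ hM h').symm

end UnboundedOp

end

namespace UnboundedOp

variable {H₁ : Type*} [NormedAddCommGroup H₁] [InnerProductSpace ℂ H₁]
variable {H₂ : Type*} [NormedAddCommGroup H₂] [InnerProductSpace ℂ H₂]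

/-! Injectivity gives `N(T) = 0`, so `C(T) = D(T)` and the two attainment conditions are literally
the same. The link with `T†` is the reciprocal relation `‖T†‖ = 1 / m(T)`, which rests on two facts
about an everywhere defined `T†`: it is a left inverse of `T`, and `‖T (T† y)‖ ≤ ‖y‖`.

If `m(T)` is attained, injectivity makes it positive, so `T` is bounded below and, being closed, has
closed range; then `T†` is defined everywhere and attains its norm at `T x₀ / m(T)`. Conversely, if
`T†` attains its norm at `y₀`, then `T† y₀ / ‖T†‖` is a unit vector at which `T` meets its lower
bound `1 / ‖T†‖`. -/

theorem nullSpace_eq_bot_of_injective {T : H₁ →ₗ.[ℂ] H₂} (hinj : Function.Injective T) :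
    nullSpace T = ⊥ := by
  rw [eq_bot_iff]
  intro x hx
  obtain ⟨h, h0⟩ := mem_nullSpace.mp hx
  have h1 : (⟨x, h⟩ : T.domain) = 0 := hinj (h0.trans T.map_zero.symm)
  exact congrArg Subtype.val h1

theorem carrier_eq_domain_of_injective {T : H₁ →ₗ.[ℂ] H₂} (hinj : Function.Injective T) :
    carrier T = T.domain := by
  rw [carrier, nullSpace_eq_bot_of_injective hinj, Submodule.bot_orthogonal_eq_top, inf_top_eq]

theorem reducedMinAttaining_iff_of_injective {T : H₁ →ₗ.[ℂ] H₂} (hinj : Function.Injective T) :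
    ReducedMinAttaining T ↔ MinAttaining T := by
  simp only [ReducedMinAttaining, MinAttaining, reducedMinModulus, minModulus,
    carrier_eq_domain_of_injective hinj, SetLike.coe_mem, true_and]

theorem minModulus_le (T : H₁ →ₗ.[ℂ] H₂) (x : T.domain) (hx : ‖(x : H₁)‖ = 1) :
    minModulus T ≤ ‖T x‖ :=
  csInf_le ⟨0, by rintro _ ⟨y, -, rfl⟩; exact norm_nonneg _⟩ ⟨x, hx, rfl⟩

theorem norm_map_real_smul (T : H₁ →ₗ.[ℂ] H₂) {r : ℝ} (hr : 0 ≤ r) (x : T.domain) :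
    ‖T ((r : ℂ) • x)‖ = r * ‖T x‖ := by
  rw [LinearPMap.map_smul, norm_smul, Complex.norm_of_nonneg hr]

theorem norm_coe_real_smul (T : H₁ →ₗ.[ℂ] H₂) {r : ℝ} (hr : 0 ≤ r) (x : T.domain) :
    ‖(((r : ℂ) • x : T.domain) : H₁)‖ = r * ‖(x : H₁)‖ := by
  rw [Submodule.coe_smul, norm_smul, Complex.norm_of_nonneg hr]

theorem minModulus_mul_norm_le (T : H₁ →ₗ.[ℂ] H₂) (x : T.domain) :
    minModulus T * ‖(x : H₁)‖ ≤ ‖T x‖ := by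
  rcases eq_or_lt_of_le (norm_nonneg (x : H₁)) with h | h
  · simp [← h]
  · have hi : 0 ≤ ‖(x : H₁)‖⁻¹ := by positivity
    have h1 := minModulus_le T (((‖(x : H₁)‖⁻¹ : ℝ) : ℂ) • x)
      (by rw [norm_coe_real_smul T hi, inv_mul_cancel₀ h.ne'])
    rw [norm_map_real_smul T hi, inv_mul_eq_div, le_div_iff₀ h] at h1
    exact h1

/-- A lower bound reached at a unit vector must be the infimum, so `m(T)` need not be computed
beforehand. -/
theorem minAttaining_of_bound {T : H₁ →ₗ.[ℂ] H₂} {c : ℝ}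
    (hc : ∀ x : T.domain, c * ‖(x : H₁)‖ ≤ ‖T x‖) (x₀ : T.domain) (hx₀ : ‖(x₀ : H₁)‖ = 1)
    (h : ‖T x₀‖ ≤ c) : MinAttaining T := by
  refine ⟨x₀, hx₀, le_antisymm (le_csInf ⟨_, x₀, hx₀, rfl⟩ ?_) (minModulus_le T x₀ hx₀)⟩
  rintro _ ⟨x, hx, rfl⟩
  have := hc x
  rw [hx, mul_one] at this
  exact h.trans this

/-- A closed operator that is bounded below has closed range. -/
theorem isClosed_rangeSpace_of_bound [CompleteSpace H₁] [CompleteSpace H₂] {T : H₁ →ₗ.[ℂ] H₂}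
    (hT : T.IsClosed) {c : ℝ} (hc0 : 0 < c) (hc : ∀ x : T.domain, c * ‖(x : H₁)‖ ≤ ‖T x‖) :
    IsClosed (rangeSpace T : Set H₂) := by
  have : CompleteSpace T.graph := IsClosed.completeSpace_coe (hs := hT)
  let f : T.graph →L[ℂ] H₂ := (ContinuousLinearMap.snd ℂ H₁ H₂).comp T.graph.subtypeL
  -- The graph carries the sup norm, so both coordinates must be controlled by `‖T u‖`: the first
  -- with constant `c⁻¹`, the second with `1`.
  have hf : AntilipschitzWith (max c⁻¹ 1).toNNReal f := by
    refine AddMonoidHomClass.antilipschitz_of_bound f fun p => ?_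
    obtain ⟨⟨x, y⟩, hp⟩ := p
    obtain ⟨u, rfl, rfl⟩ := (LinearPMap.mem_graph_iff T).mp hp
    rw [Real.coe_toNNReal _ (le_max_of_le_right zero_le_one)]
    change max ‖(u : H₁)‖ ‖T u‖ ≤ max c⁻¹ 1 * ‖T u‖
    rw [max_mul_of_nonneg _ _ (norm_nonneg _), one_mul]
    refine max_le_max_right _ ?_
    rw [inv_mul_eq_div, le_div_iff₀ hc0, mul_comm]
    exact hc u
  have hr : (rangeSpace T : Set H₂) = Set.range f := by
    ext y
    constructor
    · rintro ⟨x, rfl⟩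
      exact ⟨⟨(x, T x), T.mem_graph x⟩, rfl⟩
    · rintro ⟨⟨⟨x, y⟩, hp⟩, rfl⟩
      obtain ⟨u, -, hu⟩ := (LinearPMap.mem_graph_iff T).mp hp
      exact ⟨u, hu⟩
  rw [hr]
  exact hf.isClosed_range f.uniformContinuous

theorem toPMap_top_of_domain_eq_top (S : H₂ →ₗ.[ℂ] H₁) (h : S.domain = ⊤) :
    ∃ A : H₂ →ₗ[ℂ] H₁, S = A.toPMap ⊤ :=
  ⟨S.toFun ∘ₗ LinearMap.codRestrict S.domain LinearMap.id fun _ => h ▸ Submodule.mem_top,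
    LinearPMap.ext h fun _ _ _ => rfl⟩

/-- If the Moore-Penrose inverse is everywhere defined, then it maps into the domain
of `T`, and `‖T (A y)‖ ≤ ‖y‖`. -/
theorem exists_norm_le_of_moorePenroseInverse_eq {T : H₁ →ₗ.[ℂ] H₂} {A : H₂ →ₗ[ℂ] H₁}
    (hA : moorePenroseInverse T = A.toPMap ⊤) (y : H₂) :
    ∃ u : T.domain, (u : H₁) = A y ∧ ‖T u‖ ≤ ‖y‖ := by
  have h : (y, A y) ∈ moorePenroseGraph T := by
    rw [← moorePenroseInverse_graph, hA]
    exact LinearPMap.mem_graph (A.toPMap ⊤) ⟨y, Submodule.mem_top⟩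
  obtain ⟨u, -, hu, hy⟩ := h
  refine ⟨u, hu.symm, ?_⟩
  -- `T u` is the orthogonal projection of `y` to the range, so Pythagoras gives the bound.
  have ho : inner ℂ (T u) (y - T u) = 0 :=
    Submodule.inner_right_of_mem_orthogonal (apply_mem_rangeSpace T u) hy
  have hp := norm_add_sq_eq_norm_sq_add_norm_sq_of_inner_eq_zero (T u) (y - T u) ho
  rw [add_sub_cancel] at hp
  nlinarith [norm_nonneg (T u), norm_nonneg y, mul_self_nonneg ‖y - T u‖]

theorem apply_apply_of_moorePenroseInverse_eq {T : H₁ →ₗ.[ℂ] H₂} (hinj : Function.Injective T)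
    {A : H₂ →ₗ[ℂ] H₁} (hA : moorePenroseInverse T = A.toPMap ⊤) (x : T.domain) :
    A (T x) = x := by
  have h : (T x, (x : H₁)) ∈ (A.toPMap ⊤).graph := by
    rw [← hA, moorePenroseInverse_graph]
    exact ⟨x, by rw [carrier_eq_domain_of_injective hinj]; exact x.2, rfl, by simp⟩
  obtain ⟨u, hu, hu'⟩ := (LinearPMap.mem_graph_iff _).mp h
  exact (congrArg A hu).symm.trans hu'

theorem MinAttaining.isClosed_and_normAttaining [CompleteSpace H₁] [CompleteSpace H₂]
    {T : H₁ →ₗ.[ℂ] H₂} (hT : T.IsClosed) (hinj : Function.Injective T) (h : MinAttaining T) :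
    IsClosed (rangeSpace T : Set H₂) ∧ NormAttaining (moorePenroseInverse T) := by
  obtain ⟨x₀, hx₀, hm⟩ := h
  -- Attainment is essential here: an injective operator can have infimum zero, but cannot vanish at
  -- a unit vector.
  have hpos : 0 < minModulus T := by
    rw [← hm, norm_pos_iff]
    intro h0
    have h1 : x₀ = 0 := hinj (h0.trans T.map_zero.symm)
    simp [h1] at hx₀
  have hbound := minModulus_mul_norm_le T
  have hcl := isClosed_rangeSpace_of_bound hT hpos hbound
  refine ⟨hcl, ?_⟩
  have : CompleteSpace (rangeSpace T) := hcl.completeSpace_coe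
  obtain ⟨A, hA⟩ := toPMap_top_of_domain_eq_top (moorePenroseInverse T) <| by
    rw [(moorePenroseInverse_spec hT).domain_eq, Submodule.sup_orthogonal_of_hasOrthogonalProjection]
  have hAb : ∀ y, ‖A y‖ ≤ (minModulus T)⁻¹ * ‖y‖ := by
    intro y
    obtain ⟨u, hu, huy⟩ := exists_norm_le_of_moorePenroseInverse_eq hA y
    rw [← hu, inv_mul_eq_div, le_div_iff₀ hpos, mul_comm]
    exact (hbound u).trans huy
  have hi : 0 ≤ (minModulus T)⁻¹ := by positivity
  let B := A.mkContinuous _ hAb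
  -- The norming vector for `T†` is `T x₀ / m(T)`, which `T†` sends to `x₀ / m(T)`.
  have hy : ‖T ((((minModulus T)⁻¹ : ℝ) : ℂ) • x₀)‖ = 1 := by
    rw [norm_map_real_smul T hi, hm, inv_mul_cancel₀ hpos.ne']
  have hx : ‖B (T ((((minModulus T)⁻¹ : ℝ) : ℂ) • x₀))‖ = (minModulus T)⁻¹ := by
    change ‖A _‖ = _
    rw [apply_apply_of_moorePenroseInverse_eq hinj hA, norm_coe_real_smul T hi, hx₀, mul_one]
  refine ⟨B, hA, _, hy, le_antisymm ?_ ?_⟩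
  · exact (B.le_opNorm _).trans_eq (by rw [hy, mul_one])
  · rw [hx]
    exact A.mkContinuous_norm_le hi hAb

theorem MinAttaining.of_normAttaining [Nontrivial H₁] {T : H₁ →ₗ.[ℂ] H₂}
    (hdense : Dense (T.domain : Set H₁)) (hinj : Function.Injective T)
    (h : NormAttaining (moorePenroseInverse T)) : MinAttaining T := by
  obtain ⟨A, hA, y₀, hy₀, hAy₀⟩ := h
  have hAT : ∀ x : T.domain, A (T x) = x := apply_apply_of_moorePenroseInverse_eq hinj hA
  -- If `A = 0`, the left inverse identity forces `D(T) = 0`, which is not dense in a nontrivial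
  -- space.
  have hpos : 0 < ‖A‖ := by
    rw [norm_pos_iff]
    rintro rfl
    obtain ⟨x, hx0, hx⟩ := hdense.exists_mem_open isOpen_compl_singleton (exists_ne (0 : H₁))
    exact hx (hAT ⟨x, hx0⟩).symm
  obtain ⟨u, hu, huy⟩ := exists_norm_le_of_moorePenroseInverse_eq hA y₀
  have hi : 0 ≤ ‖A‖⁻¹ := by positivity
  -- The bound is `‖x‖ = ‖A (T x)‖ ≤ ‖A‖ ‖T x‖`; the minimizer is `A y₀` normalized.
  refine minAttaining_of_bound (c := ‖A‖⁻¹) (fun x => ?_) (((‖A‖⁻¹ : ℝ) : ℂ) • u) ?_ ?_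
  · rw [inv_mul_eq_div, div_le_iff₀ hpos, mul_comm]
    simpa [hAT] using A.le_opNorm (T x)
  · rw [norm_coe_real_smul T hi, hu]
    exact (congrArg _ hAy₀).trans (inv_mul_cancel₀ hpos.ne')
  · rw [norm_map_real_smul T hi]
    exact mul_le_of_le_one_right hi (huy.trans_eq hy₀)

end UnboundedOp

theorem theorem3p9
    {H₁ : Type*} [NormedAddCommGroup H₁] [InnerProductSpace ℂ H₁] [CompleteSpace H₁]
    {H₂ : Type*} [NormedAddCommGroup H₂] [InnerProductSpace ℂ H₂] [CompleteSpace H₂]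
    [Nontrivial H₁]
    (T : H₁ →ₗ.[ℂ] H₂)
    (hdense : Dense (T.domain : Set H₁)) (hclosed : T.IsClosed)
    (hinj : Function.Injective T) :
    List.TFAE [
      UnboundedOp.ReducedMinAttaining T,
      UnboundedOp.MinAttaining T,
      IsClosed (UnboundedOp.rangeSpace T : Set H₂) ∧
        UnboundedOp.NormAttaining (UnboundedOp.moorePenroseInverse T)] := by
  tfae_have 1 ↔ 2 := UnboundedOp.reducedMinAttaining_iff_of_injective hinj
  tfae_have 2 → 3 := fun h => h.isClosed_and_normAttaining hclosed hinj
  tfae_have 3 → 2 := fun h => .of_normAttaining hdense hinj h.2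
  tfae_finish
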